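/- Let $\mathcal C$ be a triangulated category. For objects $X,Y$ write $X\perp Y$ if $\mathcal C(X,Y)=0$; for a class $D$ of objects put $D^{\perp}=\{Y: X\perp Y\ \forall X\in D\}$ and ${}^{\perp}D=\{Y: Y\perp X\ \forall X\in D\}$. A pair $(L,R)$ of classes of objects is a *torsion theory* if $L^\perp=R$, $L={}^\perp R$, and every object $M$ lies in a distinguished triangle $A\to M\to B\to A[1]$ with $A\in L$, $B\in R$. A *weight structure* $w=(\mathcal C_{w\le 0},\mathcal C_{w\ge 0})=(L,R[-1])$ is given by a torsion theory $(L,R)$ with $L\subset L[1]$; put $\mathcal C_{w\le n}=\mathcal C_{w\le 0}[n]$ and $\mathcal C_{w\ge n}=\mathcal C_{w\ge 0}[n]$. A *$t$-structure* $t=(\mathcal C_{t\le 0},\mathcal C_{t\ge 0})=(R'[1],L')$ (homological convention) is given by a torsion theory $(L',R')$ with $L'\subset L'[-1]$; put $\mathcal C_{t\le n}=\mathcal C_{t\le 0}[n]$, $\mathcal C_{t\ge n}=\mathcal C_{t\ge 0}[n]$, and $\mathcal C[m,n]=\mathcal C_{t\le n}\cap\mathcal C_{t\ge m}$ for $m\le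 n$. The structures $w$ and $t$ are *adjacent* if $\mathcal C_{w\ge 0}=\mathcal C_{t\ge 0}$. An *$n$-weight decomposition* of $M$ is a distinguished triangle $w_{\le n}M\to M\to w_{\ge n+1}M\to (w_{\le n}M)[1]$ with $w_{\le n}M\in\mathcal C_{w\le n}$ and $w_{\ge n+1}M\in \mathcal C_{w\ge n+1}$. For $m\le n$, a morphism $g:M\to N$ *kills weights $m,\dots,n$* if for some $n$-weight decomposition of $M$ and some $(m-1)$-weight decomposition of $N$ there is a morphism $h:w_{\le n}M\to w_{\le m-1}N$ such that the composition $w_{\le n}M\to M\stackrel{g}{\to}N$ equals $w_{\le n}M\stackrel{h}{\to}w_{\le m-1}N\to N$. Let $\mathrm{Mor}_{\cancel{[m,n]}}\mathcal C$ be the class of these morphisms, and let $\mathcal C_{w\notin[m,n]}$ be the class of objects $M$ *without weights $m,\dots,n$*, i.e. such that $\mathrm{id}_M$ kills weights $m,\dots,n$. A pair $(P,J)$ of a class of objects and a class of morphisms is a *projective class* if (i) $J$ is the class of all morphisms $f$ with $\mathcal C(M,f)=0$ for all $M\in P$; (ii) an object $M$ belongs to $P$ if and only if $\mathcal C(M,f)=0$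 for all $f\in J$; (iii) every object $M$ lies in a distinguished triangle $A\to M\stackrel{j}{\to} B\to A[1]$ with $A\in P$, $j\in J$. It is an *injective class* if it is a projective class in $\mathcal C^{op}$. **Theorem.** Let the triangulated category $\mathcal C$ be endowed with a weight structure $w$ and an adjacent $t$-structure $t$, and let $m\le n$ be integers. 1. The pair $(\mathcal C_{w\notin[m,n]},\mathcal C[m,n])$ is a torsion theory. 2. The pair $(\mathcal C_{w\notin[m,n]},J_{[m,n]})$ is a projective class, where $J_{[m,n]}$ is the class of morphisms that factor through an object of $\mathcal C[m,n]$. 3. The pair $(\mathcal C[m,n],\mathrm{Mor}_{\cancel{[m,n]}}\mathcal C)$ is an injective class, and a morphism kills weights $m,\dots,n$ if and only if it factors through an object of $\mathcal C_{w\notin[m,n]}$. -/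

import Mathlib

open CategoryTheory CategoryTheory.Limits CategoryTheory.Pretriangulated
open scoped CategoryTheory.Pretriangulated.Opposite

universe v u

namespace KillWeights

section

variable {C : Type u} [Category.{v} C] [Preadditive C] [HasZeroObject C] [HasShift C ℤ]
  [∀ n : ℤ, (shiftFunctor C n).Additive] [Pretriangulated C]

/-- `(L, R)` is a torsion theory: `L^⊥ = R`, `L = ^⊥R`, and every object `M` lies in a
distinguished triangle `A ⟶ M ⟶ B ⟶ A⟦1⟧` with `A` in `L` and `B` in `R`. -/
structure IsTorsionTheory (L R : ObjectProperty C) : Prop where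
  rightOrthogonal_eq : L.rightOrthogonal = R
  eq_leftOrthogonal : L = R.leftOrthogonal
  exists_triangle (M : C) : ∃ (A B : C) (a : A ⟶ M) (b : M ⟶ B) (c : B ⟶ A⟦(1 : ℤ)⟧),
    L A ∧ R B ∧ Triangle.mk a b c ∈ distTriang C

/-- The translate `P[n]` of an isomorphism-closed class `P`: the class of the objects isomorphic to
`X⟦n⟧` for some `X` in `P`; equivalently, `Y` lies in it if and only if `Y⟦-n⟧` lies in `P`.
It is only applied to the two classes of a torsion theory, which are isomorphism-closed. -/
abbrev translate (P : ObjectProperty C) (n : ℤ) : ObjectProperty C := P.shift (-n)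

variable (C) in
/-- A weight structure on `C` (homological convention), given by the torsion theory `(L, R)`
associated with it, where `L ⊆ L[1]`. The weight structure is the pair
`(C_{w ≤ 0}, C_{w ≥ 0}) = (L, R[-1])`. -/
structure WeightStructure where
  L : ObjectProperty C
  R : ObjectProperty C
  isTorsionTheory : IsTorsionTheory L R
  weighted : L ≤ translate L 1

namespace WeightStructure

variable (w : WeightStructure C)

/-- `C_{w ≤ n} = C_{w ≤ 0}[n] = L[n]`. -/
def le (n : ℤ) : ObjectProperty C := translate w.L n

/-- `C_{w ≥ n} = C_{w ≥ 0}[n] = R[n - 1]`. -/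
def ge (n : ℤ) : ObjectProperty C := translate w.R (n - 1)

/-- `A ⟶ M ⟶ B` is (a part of) an `n`-weight decomposition of `M`, that is,
`A` is a choice of `w_{≤ n} M` and `B` is a choice of `w_{≥ n+1} M`. -/
def IsWeightDecomposition (n : ℤ) {A M B : C} (a : A ⟶ M) (b : M ⟶ B) : Prop :=
  w.le n A ∧ w.ge (n + 1) B ∧ ∃ c : B ⟶ A⟦(1 : ℤ)⟧, Triangle.mk a b c ∈ distTriang C

/-- The class of morphisms `g : M ⟶ N` that kill weights `m, …, n`: for some choice of an
`n`-weight decomposition of `M` and of an `(m-1)`-weight decomposition of `N`, there is `h`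
making the square formed by `h`, `g`, `w_{≤ n} M ⟶ M` and `w_{≤ m-1} N ⟶ N` commutative. -/
def killsWeights (m n : ℤ) : MorphismProperty C := fun M N g =>
  ∃ (A B A' B' : C) (a : A ⟶ M) (b : M ⟶ B) (a' : A' ⟶ N) (b' : N ⟶ B') (h : A ⟶ A'),
    w.IsWeightDecomposition n a b ∧ w.IsWeightDecomposition (m - 1) a' b' ∧ a ≫ g = h ≫ a'

/-- The class `C_{w ∉ [m,n]}` of objects without weights `m, …, n`. -/
def withoutWeights (m n : ℤ) : ObjectProperty C := fun M => w.killsWeights m n (𝟙 M)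

end WeightStructure

/-- `C_{t ≥ n} = C_{t ≥ 0}[n]` in the homological convention (where `C_{t ≥ 0}` is orthogonal to
`C_{t ≤ -1}` from the left). Mathlib uses the cohomological convention, hence the sign. -/
def tGE (t : Triangulated.TStructure C) (n : ℤ) : ObjectProperty C := t.le (-n)

/-- `C_{t ≤ n} = C_{t ≤ 0}[n]` in the homological convention. -/
def tLE (t : Triangulated.TStructure C) (n : ℤ) : ObjectProperty C := t.ge (-n)

/-- `C[m,n] = C_{t ≤ n} ∩ C_{t ≥ m}`. -/
def tInterval (t : Triangulated.TStructure C) (m n : ℤ) : ObjectProperty C :=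
  tLE t n ⊓ tGE t m

/-- `w` and `t` are adjacent: `C_{w ≥ 0} = C_{t ≥ 0}`. -/
def Adjacent (w : WeightStructure C) (t : Triangulated.TStructure C) : Prop :=
  w.ge 0 = tGE t 0

/-- The class of morphisms that factor through an object of `P`. -/
def factorsThrough (P : ObjectProperty C) : MorphismProperty C := fun X Y f =>
  ∃ (Z : C) (a : X ⟶ Z) (b : Z ⟶ Y), P Z ∧ a ≫ b = f

/-- `(P, J)` is a projective class. -/
structure IsProjectiveClass (P : ObjectProperty C) (J : MorphismProperty C) : Prop where
  /-- `J` is the class of all `P`-null morphisms. -/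
  mem_iff_null {X Y : C} (f : X ⟶ Y) :
    J f ↔ ∀ (M : C), P M → ∀ g : M ⟶ X, g ≫ f = 0
  /-- `C(M, -)` annihilates all elements of `J` if and only if `M` belongs to `P`. -/
  annihilates_iff (M : C) :
    (∀ (X Y : C) (f : X ⟶ Y), J f → ∀ g : M ⟶ X, g ≫ f = 0) ↔ P M
  exists_triangle (M : C) : ∃ (A B : C) (i : A ⟶ M) (j : M ⟶ B) (k : B ⟶ A⟦(1 : ℤ)⟧),
    P A ∧ J j ∧ Triangle.mk i j k ∈ distTriang C

/-- `(P, J)` is an injective class: it is a projective class in the triangulated category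
`Cᵒᵖ`. -/
def IsInjectiveClass (P : ObjectProperty C) (J : MorphismProperty C) : Prop :=
  IsProjectiveClass (C := Cᵒᵖ) P.op J.op

end

end KillWeights

/-!
The fibre of a map `b : M ⟶ B` is left orthogonal to `Z` if and only if `b` induces a surjection
on morphisms to `Z` and an injection on morphisms to `Z⟦1⟧`. These two conditions pass to
composites, so the octahedral axiom is not needed to see that maps with fibres left orthogonal
to `Z` compose. Applied to `M ⟶ w_{≥ m} M ⟶ t_{≤ n} (w_{≥ m} M)`, whose two steps have fibres in
`C_{w ≤ m-1}` and in `C_{t ≥ n+1}`, this yields a triangle `F ⟶ M ⟶ Y ⟶ F⟦1⟧` with `Y` in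
`C[m,n]` and `F` left orthogonal to `C[m,n]`. On the other hand, `g` kills weights `m, …, n`
exactly when it is annihilated by all morphisms to `C[m,n]`, which identifies the left orthogonal
with the class of objects without these weights. The statements on projective and injective
classes are formal consequences of the torsion theory.
-/

namespace KillWeights

open CategoryTheory.ObjectProperty CategoryTheory.Triangulated Function
open scoped ZeroObject

section Orthogonal

variable {C : Type*} [Category* C] [HasZeroMorphisms C] {A : Type*} [AddGroup A] [HasShift C A]

lemma rightOrthogonal_shift (P : ObjectProperty C) [P.IsClosedUnderIsomorphisms] (n : A) :
    (P.shift n).rightOrthogonal = P.rightOrthogonal.shift n := by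
  ext Y
  refine ⟨fun hY X f hX => ?_, fun hY X f hX => ?_⟩
  · obtain ⟨g, hg⟩ := (shiftFunctor C n).map_surjective ((shiftNegShift X n).hom ≫ f)
    have hg₀ : g = 0 := hY g (P.prop_of_iso (shiftNegShift X n).symm hX)
    rw [← cancel_epi (shiftNegShift X n).hom, ← hg, hg₀, Functor.map_zero, comp_zero]
  · exact (shiftFunctor C n).map_injective ((hY (f⟦n⟧') hX).trans (Functor.map_zero _ _ _).symm)

lemma leftOrthogonal_shift (P : ObjectProperty C) [P.IsClosedUnderIsomorphisms] (n : A) :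
    (P.shift n).leftOrthogonal = P.leftOrthogonal.shift n := by
  ext X
  refine ⟨fun hX Y f hY => ?_, fun hX Y f hY => ?_⟩
  · obtain ⟨g, hg⟩ := (shiftFunctor C n).map_surjective (f ≫ (shiftNegShift Y n).inv)
    have hg₀ : g = 0 := hX g (P.prop_of_iso (shiftNegShift Y n).symm hY)
    rw [← cancel_mono (shiftNegShift Y n).inv, ← hg, hg₀, Functor.map_zero, zero_comp]
  · exact (shiftFunctor C n).map_injective ((hX (f⟦n⟧') hY).trans (Functor.map_zero _ _ _).symm)

end Orthogonal

lemma op_factorsThrough {C : Type*} [Category* C] (P : ObjectProperty C) :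
    (factorsThrough P).op = factorsThrough (C := Cᵒᵖ) P.op := by
  ext X Y f
  constructor
  · rintro ⟨Z, a, b, hZ, hab⟩
    exact ⟨.op Z, b.op, a.op, hZ, Quiver.Hom.unop_inj hab⟩
  · rintro ⟨Z, a, b, hZ, rfl⟩
    exact ⟨Z.unop, b.unop, a.unop, hZ, rfl⟩

section

variable {C : Type u} [Category.{v} C] [Preadditive C] [HasZeroObject C] [HasShift C ℤ]
  [∀ n : ℤ, (shiftFunctor C n).Additive] [Pretriangulated C]

lemma hom_fibre_eq_zero_iff {A M B : C} {a : A ⟶ M} {b : M ⟶ B} {c : B ⟶ A⟦(1 : ℤ)⟧}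
    (mem : Triangle.mk a b c ∈ distTriang C) (Z : C) :
    (∀ f : A ⟶ Z, f = 0) ↔
      Surjective (Preadditive.leftComp Z b) ∧ Injective (Preadditive.leftComp (Z⟦(1 : ℤ)⟧) b) := by
  simp only [injective_iff_map_eq_zero]
  constructor
  · refine fun hA => ⟨fun f => ?_, fun g hg => ?_⟩
    · obtain ⟨g, hg⟩ := Triangle.yoneda_exact₂ _ mem f (hA _)
      exact ⟨g, hg.symm⟩
    · obtain ⟨l, rfl⟩ : ∃ l : A⟦(1 : ℤ)⟧ ⟶ Z⟦(1 : ℤ)⟧, g = c ≫ l :=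
        Triangle.yoneda_exact₃ _ mem g hg
      obtain ⟨k, rfl⟩ := (shiftFunctor C (1 : ℤ)).map_surjective l
      rw [hA k, Functor.map_zero, comp_zero]
  · rintro ⟨hsurj, hinj⟩ f
    have hbc : b ≫ c = 0 := comp_distTriang_mor_zero₂₃ _ mem
    have hcf : c ≫ f⟦(1 : ℤ)⟧' = 0 :=
      hinj _ (show b ≫ c ≫ f⟦(1 : ℤ)⟧' = 0 by rw [reassoc_of% hbc, zero_comp])
    obtain ⟨e, he, -⟩ := complete_distinguished_triangle_morphism₂ _ _ mem
      (contractible_distinguished Z) f 0 (hcf.trans zero_comp.symm)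
    obtain ⟨g, rfl⟩ := hsurj e
    have hab : a ≫ b = 0 := comp_distTriang_mor_zero₁₂ _ mem
    calc f = f ≫ 𝟙 Z := (Category.comp_id f).symm
      _ = a ≫ b ≫ g := he.symm
      _ = 0 := by rw [reassoc_of% hab, zero_comp]

lemma leftOrthogonal_fibre_comp {P : ObjectProperty C} {A X F M B Y : C}
    {a : A ⟶ M} {b : M ⟶ B} {c : B ⟶ A⟦(1 : ℤ)⟧} (hab : Triangle.mk a b c ∈ distTriang C)
    {x : X ⟶ B} {y : B ⟶ Y} {z : Y ⟶ X⟦(1 : ℤ)⟧} (hxy : Triangle.mk x y z ∈ distTriang C)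
    {f : F ⟶ M} {d : Y ⟶ F⟦(1 : ℤ)⟧} (hf : Triangle.mk f (b ≫ y) d ∈ distTriang C)
    (hA : P.leftOrthogonal A) (hX : P.leftOrthogonal X) : P.leftOrthogonal F := by
  have leftComp_comp (W : C) : ⇑(Preadditive.leftComp W (b ≫ y)) =
      Preadditive.leftComp W b ∘ Preadditive.leftComp W y :=
    funext fun g => Category.assoc b y g
  intro Z k hZ
  obtain ⟨hb, hb'⟩ := (hom_fibre_eq_zero_iff hab Z).1 fun l => hA l hZ
  obtain ⟨hy, hy'⟩ := (hom_fibre_eq_zero_iff hxy Z).1 fun l => hX l hZ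
  refine (hom_fibre_eq_zero_iff hf Z).2 ?_ k
  rw [leftComp_comp, leftComp_comp]
  exact ⟨hb.comp hy, hb'.comp hy'⟩

namespace IsTorsionTheory

variable {L R : ObjectProperty C}

lemma hom_eq_zero (h : IsTorsionTheory L R) {X Y : C} (hX : L X) (hY : R Y) (f : X ⟶ Y) :
    f = 0 := by
  rw [← h.rightOrthogonal_eq] at hY
  exact hY f hX

lemma translate (h : IsTorsionTheory L R) (n : ℤ) :
    IsTorsionTheory (translate L n) (translate R n) := by
  have : L.IsClosedUnderIsomorphisms := by rw [h.eq_leftOrthogonal]; infer_instance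
  have : R.IsClosedUnderIsomorphisms := by rw [← h.rightOrthogonal_eq]; infer_instance
  refine ⟨by rw [rightOrthogonal_shift, h.rightOrthogonal_eq],
    by rw [leftOrthogonal_shift, ← h.eq_leftOrthogonal], fun M => ?_⟩
  obtain ⟨A, B, a, b, c, hA, hB, mem⟩ := h.exists_triangle (M⟦-n⟧)
  let T := (Triangle.shiftFunctor C n).obj (Triangle.mk a b c)
  let e : T.obj₂ ≅ M := shiftNegShift M n
  refine ⟨T.obj₁, T.obj₃, T.mor₁ ≫ e.hom, e.inv ≫ T.mor₂, T.mor₃,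
    L.prop_of_iso (shiftShiftNeg A n).symm hA, R.prop_of_iso (shiftShiftNeg B n).symm hB,
    isomorphic_distinguished _ (Triangle.shift_distinguished _ mem n) _
      (Triangle.isoMk _ T (Iso.refl _) e.symm (Iso.refl _) ?_ ?_ ?_)⟩
  · change (T.mor₁ ≫ e.hom) ≫ e.inv = 𝟙 _ ≫ T.mor₁
    rw [Category.assoc, e.hom_inv_id, Category.comp_id, Category.id_comp]
  · exact Category.comp_id (e.inv ≫ T.mor₂)
  · change T.mor₃ ≫ (𝟙 _)⟦(1 : ℤ)⟧' = 𝟙 _ ≫ T.mor₃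
    rw [CategoryTheory.Functor.map_id, Category.comp_id, Category.id_comp]

lemma factorsThrough_right_iff (h : IsTorsionTheory L R) {X Y : C} (f : X ⟶ Y) :
    factorsThrough R f ↔ ∀ M : C, L M → ∀ g : M ⟶ X, g ≫ f = 0 := by
  constructor
  · rintro ⟨Z, a, b, hZ, rfl⟩ M hM g
    rw [← Category.assoc, h.hom_eq_zero hM hZ (g ≫ a), zero_comp]
  · intro hf
    obtain ⟨A, B, a, b, c, hA, hB, mem⟩ := h.exists_triangle X
    obtain ⟨g, hg⟩ := Triangle.yoneda_exact₂ _ mem f (hf A hA a)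
    exact ⟨B, b, g, hB, hg.symm⟩

lemma factorsThrough_left_iff (h : IsTorsionTheory L R) {X Y : C} (f : X ⟶ Y) :
    factorsThrough L f ↔ ∀ M : C, R M → ∀ g : Y ⟶ M, f ≫ g = 0 := by
  constructor
  · rintro ⟨Z, a, b, hZ, rfl⟩ M hM g
    rw [Category.assoc, h.hom_eq_zero hZ hM (b ≫ g), comp_zero]
  · intro hf
    obtain ⟨A, B, a, b, c, hA, hB, mem⟩ := h.exists_triangle Y
    obtain ⟨g, hg⟩ := Triangle.coyoneda_exact₂ _ mem f (hf B hB b)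
    exact ⟨A, g, a, hA, hg.symm⟩

theorem isProjectiveClass (h : IsTorsionTheory L R) :
    IsProjectiveClass L (factorsThrough R) where
  mem_iff_null f := h.factorsThrough_right_iff f
  annihilates_iff M := by
    refine ⟨fun hM => ?_, fun hM X Y f hf g => (h.factorsThrough_right_iff f).1 hf M hM g⟩
    rw [h.eq_leftOrthogonal]
    intro Z f hZ
    rw [← Category.comp_id f]
    exact hM Z Z (𝟙 Z) ⟨Z, 𝟙 Z, 𝟙 Z, hZ, Category.comp_id _⟩ f
  exists_triangle M := by
    obtain ⟨A, B, a, b, c, hA, hB, mem⟩ := h.exists_triangle M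
    exact ⟨A, B, a, b, c, hA, ⟨B, b, 𝟙 B, hB, Category.comp_id _⟩, mem⟩

theorem op (h : IsTorsionTheory L R) : IsTorsionTheory (C := Cᵒᵖ) R.op L.op where
  rightOrthogonal_eq := by
    ext Y
    rw [ObjectProperty.op_iff, h.eq_leftOrthogonal]
    exact ⟨fun hY X f hX => Quiver.Hom.op_inj (hY f.op hX),
      fun hY X f hX => Quiver.Hom.unop_inj (hY f.unop hX)⟩
  eq_leftOrthogonal := by
    ext X
    rw [ObjectProperty.op_iff, ← h.rightOrthogonal_eq]
    exact ⟨fun hX Y f hY => Quiver.Hom.unop_inj (hX f.unop hY),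
      fun hX Y f hY => Quiver.Hom.op_inj (hX f.op hY)⟩
  exists_triangle M := by
    obtain ⟨A, B, a, b, c, hA, hB, mem⟩ := h.exists_triangle M.unop
    exact ⟨_, _, _, _, _, hB, hA, op_distinguished _ mem⟩

theorem isInjectiveClass (h : IsTorsionTheory L R) : IsInjectiveClass R (factorsThrough L) := by
  rw [IsInjectiveClass, op_factorsThrough]
  exact h.op.isProjectiveClass

theorem leftOrthogonal_inf {L₁ R₁ L₂ R₂ : ObjectProperty C} (h₁ : IsTorsionTheory L₁ R₁)
    (h₂ : IsTorsionTheory L₂ R₂) (hR₁ : R₁ ≤ extensionProduct L₂ (R₁ ⊓ R₂)) :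
    IsTorsionTheory (R₁ ⊓ R₂).leftOrthogonal (R₁ ⊓ R₂) := by
  have hL₁ : L₁ ≤ (R₁ ⊓ R₂).leftOrthogonal := fun A hA Z f hZ => h₁.hom_eq_zero hA hZ.1 f
  have hL₂ : L₂ ≤ (R₁ ⊓ R₂).leftOrthogonal := fun X hX Z f hZ => h₂.hom_eq_zero hX hZ.2 f
  refine ⟨?_, rfl, fun M => ?_⟩
  · refine le_antisymm (fun Y hY => ⟨?_, ?_⟩) fun Y hY X f hX => hX f hY
    · rw [← h₁.rightOrthogonal_eq]
      exact fun A f hA => hY f (hL₁ A hA)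
    · rw [← h₂.rightOrthogonal_eq]
      exact fun X f hX => hY f (hL₂ X hX)
  · obtain ⟨A, B, a, b, c, hA, hB, hab⟩ := h₁.exists_triangle M
    obtain ⟨X, Y, x, y, z, hxy, hX, hY⟩ := hR₁ B hB
    obtain ⟨F, f, d, hf⟩ := distinguished_cocone_triangle₁ (b ≫ y)
    exact ⟨F, Y, f, b ≫ y, d,
      leftOrthogonal_fibre_comp hab hxy hf (hL₁ A hA) (hL₂ X hX), hY, hf⟩

end IsTorsionTheory

namespace WeightStructure

variable (w : WeightStructure C)

lemma isTorsionTheory_le_ge {n₀ n₁ : ℤ} (h : n₀ + 1 = n₁) :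
    IsTorsionTheory (w.le n₀) (w.ge n₁) := by
  rw [le, ge, ← h, add_sub_cancel_right]
  exact w.isTorsionTheory.translate n₀

lemma exists_isWeightDecomposition (n : ℤ) (M : C) :
    ∃ (A B : C) (a : A ⟶ M) (b : M ⟶ B), w.IsWeightDecomposition n a b := by
  obtain ⟨A, B, a, b, c, hA, hB, mem⟩ := (w.isTorsionTheory_le_ge rfl).exists_triangle M
  exact ⟨A, B, a, b, hA, hB, c, mem⟩

lemma killsWeights_iff (m n : ℤ) {M N : C} (g : M ⟶ N) :
    w.killsWeights m n g ↔ ∀ ⦃A B : C⦄ (a : A ⟶ M) (b : N ⟶ B),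
      w.le n A → w.ge m B → a ≫ g ≫ b = 0 := by
  have hn := w.isTorsionTheory_le_ge (n₀ := n) rfl
  have hm := w.isTorsionTheory_le_ge (sub_add_cancel m 1)
  constructor
  · rintro ⟨P, Q, P', Q', p, q, p', q', h, ⟨-, hq, c, mem⟩, ⟨hp', -, -⟩, comm⟩ A B a b hA hB
    obtain ⟨f, rfl⟩ : ∃ f : A ⟶ P, a = f ≫ p :=
      Triangle.coyoneda_exact₂ _ mem a (hn.hom_eq_zero hA hq _)
    calc (f ≫ p) ≫ g ≫ b = f ≫ h ≫ p' ≫ b := by rw [Category.assoc, reassoc_of% comm]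
      _ = 0 := by rw [hm.hom_eq_zero hp' hB (p' ≫ b), comp_zero, comp_zero]
  · intro hg
    obtain ⟨A, B, a, b, hab⟩ := w.exists_isWeightDecomposition n M
    obtain ⟨A', B', a', b', hab'⟩ := w.exists_isWeightDecomposition (m - 1) N
    have ⟨_, hB', c', mem'⟩ := hab'
    rw [sub_add_cancel] at hB'
    obtain ⟨h, comm⟩ := Triangle.coyoneda_exact₂ _ mem' (a ≫ g)
      ((Category.assoc _ _ _).trans (hg a b' hab.1 hB'))
    exact ⟨A, B, A', B', a, b, a', b', h, hab, hab', comm⟩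

end WeightStructure

section TStructure

variable (t : TStructure C)

lemma isTorsionTheory_tGE_tLE {n₀ n₁ : ℤ} (h : n₀ + 1 = n₁) :
    IsTorsionTheory (tGE t n₁) (tLE t n₀) where
  rightOrthogonal_eq := by
    ext Y
    simp only [tGE, tLE, t.ge_iff_isGE, t.isGE_iff_orthogonal (-n₁) (-n₀) (by lia),
      rightOrthogonal_iff, t.le_iff_isLE]
  eq_leftOrthogonal := by
    ext X
    simp only [tGE, tLE, t.le_iff_isLE, t.isLE_iff_orthogonal (-n₁) (-n₀) (by lia),
      leftOrthogonal_iff, t.ge_iff_isGE]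
  exists_triangle M := by
    obtain ⟨X, Y, hX, hY, x, y, z, mem⟩ := t.exists_triangle M (-n₁) (-n₀) (by lia)
    exact ⟨X, Y, x, y, z, hX, hY, mem⟩

lemma tGE_antitone : Antitone (tGE t) := fun _ _ h => t.le_monotone (neg_le_neg h)

lemma tGE_le_extensionProduct (m n : ℤ) :
    tGE t m ≤ extensionProduct (tGE t (n + 1)) (tInterval t m n) := by
  intro B hB
  obtain hmn | hmn := le_or_gt m n
  · obtain ⟨X, Y, x, y, z, hX, hY, mem⟩ := (isTorsionTheory_tGE_tLE t rfl).exists_triangle B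
    have hX₁ : tGE t m (X⟦(1 : ℤ)⟧) :=
      tGE_antitone t (by lia) _ (t.le_shift (-(n + 1)) 1 (-(n + 2)) (by lia) X hX)
    have hY₁ : tGE t m Y := (t.isLE₂ _ (rot_of_distTriang _ mem) (-m) ⟨hB⟩ ⟨hX₁⟩).le
    exact ⟨X, Y, x, y, z, mem, hX, hY, hY₁⟩
  · exact ⟨B, 0, 𝟙 B, 0, 0, contractible_distinguished B, tGE_antitone t hmn B hB,
      t.ge_of_isGE 0 _, t.le_of_isLE 0 _⟩

end TStructure

namespace Adjacent

variable {w : WeightStructure C} {t : TStructure C}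

lemma ge_eq_tGE (hwt : Adjacent w t) (n : ℤ) : w.ge n = tGE t n := by
  have : w.R.IsClosedUnderIsomorphisms := by
    rw [← w.isTorsionTheory.rightOrthogonal_eq]; infer_instance
  calc w.ge n = (w.ge 0).shift (-n) := (w.R.shift_shift (-n) _ _ (by lia)).symm
    _ = (t.le 0).shift (-n) := by rw [hwt, tGE, neg_zero]
    _ = tGE t n := t.shift_le _ _ _ (add_zero _)

lemma killsWeights_iff (hwt : Adjacent w t) (m n : ℤ) {M N : C} (g : M ⟶ N) :
    w.killsWeights m n g ↔ ∀ Z : C, tInterval t m n Z → ∀ z : N ⟶ Z, g ≫ z = 0 := by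
  have hw := w.isTorsionTheory_le_ge (n₀ := n) rfl
  rw [hwt.ge_eq_tGE] at hw
  have ht := isTorsionTheory_tGE_tLE t (n₀ := n) rfl
  rw [w.killsWeights_iff, hwt.ge_eq_tGE]
  constructor
  · intro hg Z hZ z
    obtain ⟨B, b, k, hB, hbk⟩ :=
      (hw.factorsThrough_right_iff (g ≫ z)).2 fun A hA a => hg a z hA hZ.2
    rw [← hbk, ht.hom_eq_zero hB hZ.1 k, comp_zero]
  · intro hg A B a b hA hB
    obtain ⟨X, Y, x, y, z, mem, hX, hY⟩ := tGE_le_extensionProduct t m n B hB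
    have hy : (a ≫ g ≫ b) ≫ y = 0 := by
      rw [Category.assoc, Category.assoc, hg Y hY (b ≫ y), comp_zero]
    obtain ⟨k, hk⟩ : ∃ k : A ⟶ X, a ≫ g ≫ b = k ≫ x :=
      Triangle.coyoneda_exact₂ _ mem (a ≫ g ≫ b) hy
    rw [hk, hw.hom_eq_zero hA hX k, zero_comp]

lemma withoutWeights_eq_leftOrthogonal (hwt : Adjacent w t) (m n : ℤ) :
    w.withoutWeights m n = (tInterval t m n).leftOrthogonal := by
  ext M
  rw [WeightStructure.withoutWeights, hwt.killsWeights_iff, leftOrthogonal_iff]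
  simp only [Category.id_comp]
  exact forall_congr' fun Z => forall_comm

theorem isTorsionTheory (hwt : Adjacent w t) (m n : ℤ) :
    IsTorsionTheory (w.withoutWeights m n) (tInterval t m n) := by
  have hw := w.isTorsionTheory_le_ge (sub_add_cancel m 1)
  have ht := isTorsionTheory_tGE_tLE t (n₀ := n) rfl
  have hm := tGE_le_extensionProduct t m n
  rw [hwt.ge_eq_tGE] at hw
  rw [tInterval, inf_comm] at hm
  rw [hwt.withoutWeights_eq_leftOrthogonal, tInterval, inf_comm]
  exact hw.leftOrthogonal_inf ht hm

theorem killsWeights_eq_factorsThrough (hwt : Adjacent w t) (m n : ℤ) :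
    w.killsWeights m n = factorsThrough (w.withoutWeights m n) := by
  ext M N g
  rw [hwt.killsWeights_iff, (hwt.isTorsionTheory m n).factorsThrough_left_iff]

end Adjacent

end

end KillWeights

theorem theorem3p4_general {C : Type u} [Category.{v} C] [Preadditive C] [HasZeroObject C]
    [HasShift C ℤ] [∀ n : ℤ, (shiftFunctor C n).Additive] [Pretriangulated C]
    (w : KillWeights.WeightStructure C) (t : Triangulated.TStructure C)
    (hwt : KillWeights.Adjacent w t) (m n : ℤ) :
    KillWeights.IsTorsionTheory (w.withoutWeights m n) (KillWeights.tInterval t m n) ∧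
    KillWeights.IsProjectiveClass (w.withoutWeights m n)
      (KillWeights.factorsThrough (KillWeights.tInterval t m n)) ∧
    KillWeights.IsInjectiveClass (KillWeights.tInterval t m n) (w.killsWeights m n) ∧
    w.killsWeights m n = KillWeights.factorsThrough (w.withoutWeights m n) := by
  have torsion := hwt.isTorsionTheory m n
  have kills := hwt.killsWeights_eq_factorsThrough m n
  exact ⟨torsion, torsion.isProjectiveClass, kills ▸ torsion.isInjectiveClass, kills⟩

theorem theorem3p4 {C : Type u} [Category.{v} C] [Preadditive C] [HasZeroObject C]
    [HasShift C ℤ] [∀ n : ℤ, (shiftFunctor C n).Additive] [Pretriangulated C]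
    [IsTriangulated C] (w : KillWeights.WeightStructure C)
    (t : Triangulated.TStructure C) (hwt : KillWeights.Adjacent w t)
    (m n : ℤ) (hmn : m ≤ n) :
    KillWeights.IsTorsionTheory (w.withoutWeights m n) (KillWeights.tInterval t m n) ∧
    KillWeights.IsProjectiveClass (w.withoutWeights m n)
      (KillWeights.factorsThrough (KillWeights.tInterval t m n)) ∧
    KillWeights.IsInjectiveClass (KillWeights.tInterval t m n) (w.killsWeights m n) ∧
    w.killsWeights m n = KillWeights.factorsThrough (w.withoutWeights m n) := by
  exact theorem3p4_general w t hwt m n
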